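/- Let $p$ be an odd prime and let $n>1$ be an integer. Let $\mathcal N_2$ be the class of groups $G$ with $G'=[G,G]\subseteq Z(G)$ (nilpotent of class at most two), and let $\mathcal B_{k}$ be the class of groups satisfying $g^{k}=e$ for all elements $g$; write $\mathcal C=\mathcal N_2\cap\mathcal B_{p^n}$. A group $G\in\mathcal C$ is called absolutely closed in $\mathcal C$ (a special amalgamation base for $\mathcal C$) if, for all $A,A'\in\mathcal C$ with injective homomorphisms $\Phi\colon G\to A$ and $\Phi'\colon G\to A'$ for which there is an isomorphism $\psi\colon A\to A'$ with $\psi\circ\Phi=\Phi'$, there exist $M\in\mathcal C$ and injective homomorphisms $\lambda\colon A\to M$, $\lambda'\colon A'\to M$ such that $\lambda\circ\Phi=\lambda'\circ\Phi'$ and $\lambda(a)\neq\lambda'(a')$ whenever $a\in A\setminus\Phi(G)$ and $a'\in A'\setminus\Phi'(G)$. Let $G\in\mathcal N_2\cap\mathcal B_{p^n}$ (not necessarily finite). (i) If $G$ is abelian, then $G$ is absolutely closed in $\mathcal N_2\cap\mathcal B_{p^n}$ if and only if $G/pG$ is cyclic or trivial, where $pG$ denotes the subgroup of $p$-th powers $\{g^p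 : g\in G\}$. Moreover, $G$ is absolutely closed in $\mathcal N_2\cap\mathcal B_{p^n}$ if and only if $G$ is cyclic or trivial. (ii) If $G$ is of exponent $p$ (that is, $g^p=e$ for all $g\in G$), then $G$ is absolutely closed in $\mathcal N_2\cap\mathcal B_{p^n}$ if and only if $Z(G)/G'$ is cyclic or trivial. -/

import Mathlib

universe u

/-- A class of groups, given by its membership predicate. -/
abbrev GroupClass : Type (u + 1) := ∀ (G : Type u) [Group G], Prop

/-- The variety `N₂` of nilpotent groups of class at most two: `[G, G] ⊆ Z(G)`. -/
def NilTwo : GroupClass.{u} := fun G _ => commutator G ≤ Subgroup.center G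

/-- The variety `B_k` of groups of exponent `k`: groups satisfying the identity `g ^ k = e`. -/
def ExponentVariety (k : ℕ) : GroupClass.{u} := fun G _ => ∀ g : G, g ^ k = 1

/-- The variety `N₂ ∩ B_k`. -/
def NilTwoExponent (k : ℕ) : GroupClass.{u} := fun G _ => NilTwo G ∧ ExponentVariety k G

/-- The amalgam `(A, C; B)` given by `ΦA : B → A` and `ΦC : B → C` is strongly embeddable in the
class `𝒞`: it embeds in a group `M` of `𝒞` with no identification between elements of `A` outside
`B` and elements of `C` outside `B`. -/
def StronglyEmbeddable (𝒞 : GroupClass.{u}) {A B C : Type u} [Group A] [Group B] [Group C]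
    (ΦA : B →* A) (ΦC : B →* C) : Prop :=
  ∃ (M : Type u) (_ : Group M) (lA : A →* M) (lC : C →* M),
    𝒞 M ∧ Function.Injective lA ∧ Function.Injective lC ∧
    lA.comp ΦA = lC.comp ΦC ∧
    ∀ (a : A) (c : C), a ∉ ΦA.range → c ∉ ΦC.range → lA a ≠ lC c

/-- `G` is absolutely closed in `𝒞` (a special amalgamation base for `𝒞`): `G` belongs to `𝒞`, and
every special amalgam `(A, A'; G)` of groups of `𝒞` with core `G` is strongly embeddable in `𝒞`.
An amalgam is special when some isomorphism `ψ : A ≃ A'` carries one embedding of the core to the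
other. -/
def AbsolutelyClosed (𝒞 : GroupClass.{u}) (G : Type u) [Group G] : Prop :=
  𝒞 G ∧
  ∀ (A A' : Type u) [Group A] [Group A'], 𝒞 A → 𝒞 A' →
    ∀ (Φ : G →* A) (Φ' : G →* A'), Function.Injective Φ → Function.Injective Φ' →
      (∃ ψ : A ≃* A', ψ.toMonoidHom.comp Φ = Φ') → StronglyEmbeddable 𝒞 Φ Φ'

/-! Let `G ≤ A`, and let `r`, `s` in `A` have `r^q` and `s^q` in `G` modulo commutators. In class
two, `[r, s]^q` can be rewritten through either power, so two homomorphisms that agree on `G` also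
agree on it; a strong embedding therefore forces `[r, s]^q ∈ G`
(`StronglyEmbeddable.commutator_pow_mem`). Conversely this is the only obstruction: if every
character of `Z(A)` trivial on `G ∩ Z(A)` kills these elements, any `a ∉ G` is separated by two
homomorphisms agreeing on `G` (`NilTwoExponent.exists_separating_homs`), and a product over all `a`
gives the strong embedding.

For the converse, put `U = A/A'`, let `B` be the image of `G` in `U`, and `V = U/B`. The hard case
is `a = bc` with `b ∈ G`, `c ∈ A'`. Take a character `χ` with `χ(c) ≠ 0` and seek `δ` on `A`, zero
on `G` and equal to `χ` on `A'`, whose coboundary is a bilinear `β` factoring through `U × V`. Then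
`x ↦ (x, 1, 0)` and `x ↦ (x, x̄, δ x)` are homomorphisms into a central extension of `A × V`. Such a
`β` must antisymmetrize to `χ([x, y])`, which fixes it on `B × V`; the obstruction to extending it
to `U × V` is the kernel of `V ⊗ B → V ⊗ U`, where the hypothesis on `q` enters.

The hypothesis holds when `r^q` and `s^q` are powers of one element modulo commutators, which
settles cyclic `G`. In exponent `p`, either `p ∣ q` and both powers come from `Z(G)`, or `r` and `s`
already lie in `G` modulo commutators.

For necessity, two independent classes `x`, `y` in `G/pG`, or in the image of `Z(G)` in `G/G'`,
allow an overgroup with a Heisenberg factor over `ZMod (p ^ 2)` where `x`, `y` are `p`-th powers of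
`r`, `s` modulo commutators while `[r, s]^p ∉ G` (`not_absolutelyClosed_of_dual_pair`). -/

open scoped commutatorElement

/-! ### Characters of bounded abelian groups -/

/-- The subgroup of elements of `ℚ / ℤ` killed by `k`. -/
abbrev CircleTorsion (k : ℕ) : AddSubgroup (AddCircle (1 : ℚ)) :=
  (nsmulAddMonoidHom k : AddCircle (1 : ℚ) →+ AddCircle (1 : ℚ)).ker

namespace CircleTorsion

variable {k : ℕ}

theorem nsmul_eq_zero (t : CircleTorsion k) : k • t = 0 :=
  Subtype.ext t.2

/-- `ℚ / ℤ` is divisible, hence injective; since `k` kills `Y`, the extended map cannot leave the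
`k`-torsion. -/
theorem exists_extension {X Y : Type*} [AddCommGroup X] [AddCommGroup Y] (hY : ∀ y : Y, k • y = 0)
    (i : X →+ Y) (f : X →+ CircleTorsion k) (h : ∀ x, i x = 0 → f x = 0) :
    ∃ F : Y →+ CircleTorsion k, ∀ x, F (i x) = f x := by
  let g : X ⧸ i.ker →+ AddCircle (1 : ℚ) :=
    QuotientAddGroup.lift i.ker ((CircleTorsion k).subtype.comp f) fun x hx => by
      simp [h x hx]
  obtain ⟨F, hF⟩ := (Module.Baer.of_divisible (AddCircle (1 : ℚ))).extension_property_addMonoidHom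
    (QuotientAddGroup.kerLift i) (QuotientAddGroup.kerLift_injective i) g
  refine ⟨F.codRestrict (CircleTorsion k) fun y => ?_, fun x => Subtype.ext ?_⟩
  · change k • F y = 0
    rw [← map_nsmul, hY, map_zero]
  · exact DFunLike.congr_fun hF (x : X ⧸ i.ker)

theorem exists_ne_zero {Y : Type*} [AddCommGroup Y] (hY : ∀ y : Y, k • y = 0) {y : Y} (hy : y ≠ 0) :
    ∃ F : Y →+ CircleTorsion k, F y ≠ 0 := by
  obtain ⟨c, hc⟩ := CharacterModule.exists_character_apply_ne_zero_of_ne_zero hy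
  let c' : Y →+ AddCircle (1 : ℚ) := c
  refine ⟨c'.codRestrict (CircleTorsion k) fun y => ?_, fun h => hc (congrArg Subtype.val h)⟩
  change k • c' y = 0
  rw [← map_nsmul, hY, map_zero]

theorem half_add_half (hk : Odd k) (t : CircleTorsion k) :
    ((k + 1) / 2) • t + ((k + 1) / 2) • t = t := by
  rw [← add_nsmul]
  obtain ⟨m, rfl⟩ := hk
  rw [show (2 * m + 1 + 1) / 2 + (2 * m + 1 + 1) / 2 = (2 * m + 1) + 1 by omega, add_nsmul,
    nsmul_eq_zero, zero_add, one_nsmul]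

end CircleTorsion

/-! ### Tensor kernels and bilinear splittings of alternating forms -/

/-- A finite abelian group is spanned by elements `e i`, with coordinates modulo `q i`. -/
theorem AddCommGroup.exists_cyclic_coordinates (V : Type*) [AddCommGroup V] [Finite V] :
    ∃ (ι : Type) (_ : Fintype ι) (q : ι → ℕ) (e : ι → V) (c : ∀ i, V →+ ZMod (q i)),
      (∀ i, q i • e i = 0) ∧ (∀ i, c i (e i) = 1) ∧ (∀ i j, i ≠ j → c i (e j) = 0) ∧
      ∀ v, ∃ a : ι → ℤ, v = ∑ i, a i • e i := by
  classical
  obtain ⟨ι, hι, p, -, n, ⟨E⟩⟩ := AddCommGroup.equiv_directSum_zmod_of_finite V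
  refine ⟨ι, hι, fun i => p i ^ n i, fun i => E.symm (DirectSum.of _ i 1),
    fun i => (DFinsupp.evalAddMonoidHom i).comp E.toAddMonoidHom, fun i => ?_, fun i => ?_,
    fun i j hij => ?_, fun v => ?_⟩
  · rw [← map_nsmul, ← map_nsmul]
    have : p i ^ n i • (1 : ZMod (p i ^ n i)) = 0 := by
      rw [nsmul_eq_mul, mul_one, ZMod.natCast_self]
    rw [this, map_zero, map_zero]
  · change E (E.symm _) i = 1
    rw [AddEquiv.apply_symm_apply]
    exact DirectSum.of_eq_same (β := fun i => ZMod (p i ^ n i)) i 1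
  · change E (E.symm _) i = 0
    rw [AddEquiv.apply_symm_apply]
    exact DirectSum.of_eq_of_ne (β := fun i => ZMod (p i ^ n i)) j i 1 hij
  · choose a ha using fun i => ZMod.intCast_surjective (E v i)
    refine ⟨a, E.injective ?_⟩
    rw [map_sum]
    conv_lhs => rw [← DirectSum.sum_univ_of (E v)]
    refine Finset.sum_congr rfl fun i _ => ?_
    rw [map_zsmul, AddEquiv.apply_symm_apply, ← map_zsmul, ← ha i, zsmul_eq_mul, mul_one]

open TensorProduct in
/-- The kernel of `V ⊗ B → V ⊗ U` is spanned by the tensors `v ⊗ q • u` with `q • v = 0`. -/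
theorem TensorProduct.eq_zero_of_lTensor_subtype_eq_zero {V U T : Type*} [AddCommGroup V]
    [AddCommGroup U] [AddCommGroup T] {k : ℕ} (hk : 0 < k) (hV : ∀ v : V, k • v = 0)
    (B : Submodule ℤ U) (f : V ⊗[ℤ] B →ₗ[ℤ] T)
    (hf : ∀ (q : ℕ) (v : V) (u : U) (hu : q • u ∈ B), q • v = 0 → f (v ⊗ₜ ⟨q • u, hu⟩) = 0)
    (ξ : V ⊗[ℤ] B) (hξ : B.subtype.lTensor V ξ = 0) : f ξ = 0 := by
  classical
  -- The tensor and the relations that make it vanish involve finitely many elements of `V`, so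
  -- everything descends to a finitely generated `Q`, finite because `k` kills it.
  obtain ⟨P, hP, t, rfl⟩ := Submodule.exists_fg_le_eq_rTensor_subtype ξ
  have h0 : P.subtype.rTensor U (B.subtype.lTensor P t) = 0 := by
    rw [← hξ]
    rw [← LinearMap.comp_apply, LinearMap.rTensor_comp_lTensor, ← LinearMap.lTensor_comp_rTensor,
      LinearMap.comp_apply]
  obtain ⟨Q, hPQ, hQ, h⟩ := TensorProduct.eq_zero_of_fg_of_subtype_eq_zero hP h0
  have hfin : Module.Finite ℤ Q := Module.Finite.iff_fg.mpr hQ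
  have : Finite Q := Module.finite_of_fg_torsion Q fun {x} =>
    ⟨⟨(k : ℤ), mem_nonZeroDivisors_of_ne_zero (by exact_mod_cast hk.ne')⟩,
      Subtype.ext (by simpa using hV x)⟩
  set s : Q ⊗[ℤ] B := (Submodule.inclusion hPQ).rTensor B t with hs
  have hs0 : B.subtype.lTensor Q s = 0 := by
    rw [← h]
    rw [hs, ← LinearMap.comp_apply, LinearMap.lTensor_comp_rTensor,
      ← LinearMap.rTensor_comp_lTensor, LinearMap.comp_apply]
  have hfs : f (P.subtype.rTensor B t) = f (Q.subtype.rTensor B s) := by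
    rw [hs, ← LinearMap.comp_apply (LinearMap.rTensor B Q.subtype), ← LinearMap.rTensor_comp]
    rfl
  rw [hfs]
  obtain ⟨ι, _, q, e, c, hqe, hce, hce', hspan⟩ := AddCommGroup.exists_cyclic_coordinates Q
  have hsum : ∀ s : Q ⊗[ℤ] B, ∃ b : ι → B, s = ∑ i, e i ⊗ₜ b i := by
    intro s
    induction s with
    | zero => exact ⟨0, by simp⟩
    | tmul v b =>
      obtain ⟨a, rfl⟩ := hspan v
      refine ⟨fun i => a i • b, ?_⟩
      rw [TensorProduct.sum_tmul]
      exact Finset.sum_congr rfl fun i _ => TensorProduct.smul_tmul _ _ _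
    | add x y hx hy =>
      obtain ⟨b, rfl⟩ := hx
      obtain ⟨b', rfl⟩ := hy
      refine ⟨b + b', ?_⟩
      simp only [Pi.add_apply, TensorProduct.tmul_add, Finset.sum_add_distrib]
  obtain ⟨b, hb⟩ := hsum s
  rw [hb, map_sum, map_sum]
  rw [hb, map_sum] at hs0
  refine Finset.sum_eq_zero fun i _ => ?_
  let m : U →+ U := nsmulAddMonoidHom (q i)
  -- `Λ` reads off the `i`-th coordinate of `Q ⊗ U` in `U / q i U`. Its vanishing says that `b i` is
  -- divisible by `q i` in `U`, the form that `hf` handles.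
  let F : ZMod (q i) →+ U →+ U ⧸ m.range := ZMod.lift (q i)
    ⟨zmultiplesHom _ (QuotientAddGroup.mk' m.range), by
      ext u
      rw [zmultiplesHom_apply, natCast_zsmul, AddMonoidHom.nsmul_apply, ← map_nsmul]
      exact (QuotientAddGroup.eq_zero_iff _).mpr ⟨u, rfl⟩⟩
  have hF1 : F 1 = QuotientAddGroup.mk' m.range := by
    have := ZMod.lift_coe (q i) (A := U →+ U ⧸ m.range) ⟨zmultiplesHom _ (QuotientAddGroup.mk' m.range), by
      ext u
      rw [zmultiplesHom_apply, natCast_zsmul, AddMonoidHom.nsmul_apply, ← map_nsmul]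
      exact (QuotientAddGroup.eq_zero_iff _).mpr ⟨u, rfl⟩⟩ 1
    simpa using this
  let Λ : Q ⊗[ℤ] U →+ U ⧸ m.range := TensorProduct.liftAddHom (F.comp (c i)) fun r v u => by
    rw [map_zsmul, map_zsmul, AddMonoidHom.zsmul_apply]
  have hΛ := congrArg Λ hs0
  rw [map_sum, map_zero, Finset.sum_eq_single i] at hΛ
  · have h1 : F (c i (e i)) (b i : U) = 0 := hΛ
    rw [hce, hF1] at h1
    obtain ⟨u, hu⟩ := (QuotientAddGroup.eq_zero_iff _).mp h1
    have hu' : q i • u = (b i : U) := hu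
    have h2 := hf (q i) (e i : V) u (hu' ▸ (b i).2) (congrArg Subtype.val (hqe i))
    rw [← h2]
    change f ((e i : V) ⊗ₜ b i) = _
    congr 2
    exact Subtype.ext hu'.symm
  · intro j _ hj
    change F (c i (e j)) (b j : U) = 0
    rw [hce' i j hj.symm, map_zero, AddMonoidHom.zero_apply]
  · simp

open TensorProduct in
/-- An alternating form `ω` vanishing on `B × B`, and satisfying `q ω(r, s) = 0` whenever
`q r, q s ∈ B`, is the antisymmetrization of a bilinear form vanishing on `U × B`. -/
theorem exists_bilinear_splitting {U : Type*} [AddCommGroup U] {k : ℕ} (hk : Odd k)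
    (hU : ∀ u : U, k • u = 0) (B : AddSubgroup U) (ω : U →+ U →+ CircleTorsion k)
    (halt : ∀ x, ω x x = 0) (hB : ∀ b ∈ B, ∀ b' ∈ B, ω b b' = 0)
    (hq : ∀ (q : ℕ) (r s : U), q • r ∈ B → q • s ∈ B → q • ω r s = 0) :
    ∃ β : U →+ U →+ CircleTorsion k,
      (∀ x, ∀ b ∈ B, β x b = 0) ∧ ∀ x y, β x y - β y x = ω x y := by
  have hanti : ∀ x y, ω x y = -ω y x := fun x y => by
    have h := halt (x + y)
    simp only [map_add, AddMonoidHom.add_apply, halt, zero_add, add_zero] at h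
    exact eq_neg_of_add_eq_zero_right h
  let S : Submodule ℤ U := AddSubgroup.toIntSubmodule B
  -- The values forced on `B`: since `β y b = 0`, necessarily `β b y = ω b y`, which depends only on
  -- `y` modulo `B` because `ω` vanishes on `B × B`.
  let φ : U ⧸ B →+ S →+ CircleTorsion k := QuotientAddGroup.lift B
    ((AddMonoidHom.compHom' S.subtype.toAddMonoidHom).comp ω.flip) fun b hb => by
      ext1 b'
      exact hB b' b'.2 b hb
  let f : (U ⧸ B) ⊗[ℤ] S →+ CircleTorsion k := TensorProduct.liftAddHom φ fun r v b => by
    rw [map_zsmul, map_zsmul, AddMonoidHom.zsmul_apply]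
  have hV : ∀ v : U ⧸ B, k • v = 0 := fun v => by
    induction v using QuotientAddGroup.induction_on with
    | H u => rw [← QuotientAddGroup.mk_nsmul, hU, QuotientAddGroup.mk_zero]
  obtain ⟨F, hF⟩ := CircleTorsion.exists_extension (k := k) (Y := (U ⧸ B) ⊗[ℤ] U)
    (fun y => by
      induction y with
      | zero => simp
      | tmul v u => rw [← TensorProduct.tmul_smul, hU, TensorProduct.tmul_zero]
      | add x y hx hy => rw [nsmul_add, hx, hy, add_zero])
    (S.subtype.lTensor (U ⧸ B)).toAddMonoidHom f fun ξ hξ =>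
      TensorProduct.eq_zero_of_lTensor_subtype_eq_zero hk.pos hV S f.toIntLinearMap
        (fun q v u hu hv => by
          induction v using QuotientAddGroup.induction_on with
          | H s =>
            change ω (q • u) s = 0
            rw [map_nsmul]
            refine hq q u s hu ?_
            rwa [← QuotientAddGroup.mk_nsmul, QuotientAddGroup.eq_zero_iff] at hv) ξ hξ
  let β₀ : U →+ U →+ CircleTorsion k := AddMonoidHom.mk' (fun x => AddMonoidHom.mk'
    (fun y => F ((y : U ⧸ B) ⊗ₜ x))
    fun y y' => by rw [QuotientAddGroup.mk_add, TensorProduct.add_tmul, map_add])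
    fun x x' => by
      ext1 y
      change F ((y : U ⧸ B) ⊗ₜ (x + x')) = F _ + F _
      rw [TensorProduct.tmul_add, map_add]
  have h1 : ∀ x, ∀ b ∈ B, β₀ x b = 0 := fun x b hb => by
    change F ((b : U ⧸ B) ⊗ₜ x) = 0
    rw [(QuotientAddGroup.eq_zero_iff b).mpr hb, TensorProduct.zero_tmul, map_zero]
  have h2 : ∀ b ∈ B, ∀ y, β₀ b y = ω b y := fun b hb y =>
    hF ((y : U ⧸ B) ⊗ₜ (⟨b, hb⟩ : S))
  -- The defect of `β₀`. It is antisymmetric and vanishes on `U × B`, so adding half of it corrects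
  -- the antisymmetrization and keeps the vanishing; halving needs `k` odd.
  let γ : U →+ U →+ CircleTorsion k := ω - β₀ + β₀.flip
  have hγ : ∀ x y, γ x y = ω x y - β₀ x y + β₀ y x := fun _ _ => rfl
  refine ⟨β₀ + ((k + 1) / 2) • γ, fun x b hb => ?_, fun x y => ?_⟩
  · rw [AddMonoidHom.add_apply, AddMonoidHom.add_apply, AddMonoidHom.nsmul_apply,
      AddMonoidHom.nsmul_apply, hγ, h1 x b hb, h2 b hb, hanti x b]
    simp
  · simp only [AddMonoidHom.add_apply, AddMonoidHom.nsmul_apply]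
    have h3 : γ y x = -γ x y := by rw [hγ, hγ, hanti y x]; abel
    rw [h3, smul_neg]
    have h4 := CircleTorsion.half_add_half hk (γ x y)
    rw [hγ] at h4 ⊢
    generalize ((k + 1) / 2) • (ω x y - β₀ x y + β₀ y x) = z at *
    have : ω x y = z + z + β₀ x y - β₀ y x := by rw [h4]; abel
    rw [this]; abel

/-- If `q r` and `q s` are multiples of one element, then `q ω(r, s) = 0` for `ω` alternating. -/
theorem nsmul_alternating_eq_zero {U T : Type*} [AddCommGroup U] [AddCommGroup T]
    (ω : U →+ U →+ T) (halt : ∀ x, ω x x = 0) (q : ℕ) (r s z : U) (a b : ℤ)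
    (hr : q • r = a • z) (hs : q • s = b • z) : q • ω r s = 0 := by
  have hanti : ω s r = -ω r s := by
    have h := halt (r + s)
    simp only [map_add, AddMonoidHom.add_apply, halt, zero_add, add_zero] at h
    exact eq_neg_of_add_eq_zero_left h
  obtain h0 | h0 := eq_or_ne (Int.gcd a b) 0
  · obtain ⟨rfl, rfl⟩ := Int.gcd_eq_zero_iff.mp h0
    rw [← AddMonoidHom.nsmul_apply, ← map_nsmul, hr, zero_smul, map_zero, AddMonoidHom.zero_apply]
  obtain ⟨a', ha⟩ := Int.gcd_dvd_left a b
  obtain ⟨b', hb⟩ := Int.gcd_dvd_right a b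
  have hbez : a' * Int.gcdA a b + b' * Int.gcdB a b = 1 := by
    have h := Int.gcd_eq_gcd_ab a b
    have hd : ((Int.gcd a b : ℕ) : ℤ) ≠ 0 := by exact_mod_cast h0
    apply mul_left_cancel₀ hd
    generalize Int.gcdA a b = u at *
    generalize Int.gcdB a b = v at *
    linear_combination (-1 : ℤ) * h - u * ha - v * hb
  generalize Int.gcdA a b = u at hbez
  generalize Int.gcdB a b = v at hbez
  -- A unimodular change of the pair `r`, `s`: the first new element is killed by `q`, and
  -- determinant one preserves the value of `ω`.
  have hzero : q • (b' • r - a' • s) = 0 := by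
    rw [nsmul_sub, smul_comm q b', smul_comm q a', hr, hs, smul_smul, smul_smul, ← sub_smul]
    have : b' * a - a' * b = 0 := by
      generalize (Int.gcd a b : ℤ) = d at ha hb
      rw [ha, hb]; ring
    rw [this, zero_smul]
  have key : ω (b' • r - a' • s) (u • r + v • s) = ω r s := by
    simp only [map_sub, map_add, map_zsmul, AddMonoidHom.sub_apply, AddMonoidHom.zsmul_apply, halt,
      smul_zero, hanti, smul_neg]
    rw [zero_sub, sub_zero, neg_neg, smul_smul, smul_smul, ← add_smul, show u * a' + v * b' = 1 by linarith, one_smul]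
  rw [← key, ← AddMonoidHom.nsmul_apply, ← map_nsmul, hzero, map_zero, AddMonoidHom.zero_apply]

/-! ### Groups of class two and their central extensions -/

theorem map_mem_commutator {G H : Type*} [Group G] [Group H] (f : G →* H) {x : G}
    (hx : x ∈ commutator G) : f x ∈ commutator H := by
  have h : f x ∈ (commutator G).map f := ⟨x, hx, rfl⟩
  rw [commutator_def, Subgroup.map_commutator] at h
  exact Subgroup.commutator_mono le_top le_top h

theorem NilTwo.of_comm {C : Type*} [CommGroup C] : NilTwo C :=
  fun x _ => Subgroup.mem_center_iff.mpr fun y => mul_comm y x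

theorem NilTwoExponent.prod {X Y : Type*} [Group X] [Group Y] {k : ℕ} (hX : NilTwoExponent k X)
    (hY : NilTwoExponent k Y) : NilTwoExponent k (X × Y) := by
  refine ⟨fun x hx => Subgroup.mem_center_iff.mpr fun y => ?_,
    fun x => Prod.ext (hX.2 x.1) (hY.2 x.2)⟩
  exact Prod.ext
    (Subgroup.mem_center_iff.mp (hX.1 (map_mem_commutator (MonoidHom.fst X Y) hx)) y.1)
    (Subgroup.mem_center_iff.mp (hY.1 (map_mem_commutator (MonoidHom.snd X Y) hx)) y.2)

theorem NilTwoExponent.pi {ι : Type*} {X : ι → Type*} [∀ i, Group (X i)] {k : ℕ}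
    (hX : ∀ i, NilTwoExponent k (X i)) : NilTwoExponent k (∀ i, X i) := by
  refine ⟨fun x hx => Subgroup.mem_center_iff.mpr fun y => ?_, fun x => funext fun i => (hX i).2 _⟩
  exact funext fun i =>
    Subgroup.mem_center_iff.mp ((hX i).1 (map_mem_commutator (Pi.evalMonoidHom X i) hx)) (y i)

/-- A map `X × X → T` that is a homomorphism in each variable. -/
structure BimulForm (X T : Type*) [Group X] [AddCommGroup T] where
  toFun : X → X → T
  map_mul_left : ∀ x x' y, toFun (x * x') y = toFun x y + toFun x' y
  map_mul_right : ∀ x y y', toFun x (y * y') = toFun x y + toFun x y'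

namespace BimulForm

variable {X T : Type*} [Group X] [AddCommGroup T] (β : BimulForm X T)

instance : CoeFun (BimulForm X T) fun _ => X → X → T := ⟨toFun⟩

/-- The homomorphism in the first variable. -/
def left (y : X) : X →* Multiplicative T :=
  MonoidHom.mk' (fun x => Multiplicative.ofAdd (β x y)) fun x x' => β.map_mul_left x x' y

/-- The homomorphism in the second variable. -/
def right (x : X) : X →* Multiplicative T :=
  MonoidHom.mk' (fun y => Multiplicative.ofAdd (β x y)) fun y y' => β.map_mul_right x y y'

@[simp] theorem one_left (y : X) : β 1 y = 0 := (β.left y).map_one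

@[simp] theorem one_right (x : X) : β x 1 = 0 := (β.right x).map_one

@[simp] theorem inv_left (x y : X) : β x⁻¹ y = -β x y := (β.left y).map_inv x

theorem pow_left (x y : X) (m : ℕ) : β (x ^ m) y = m • β x y := (β.left y).map_pow x m

theorem commutator_left {x : X} (hx : x ∈ commutator X) (y : X) : β x y = 0 :=
  Abelianization.commutator_subset_ker (β.left y) hx

theorem commutator_right {y : X} (hy : y ∈ commutator X) (x : X) : β x y = 0 :=
  Abelianization.commutator_subset_ker (β.right x) hy

end BimulForm

/-- The central extension of `X` by `T` with cocycle a bimultiplicative form `β`. -/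
@[ext] structure BimulForm.Ext {X T : Type*} [Group X] [AddCommGroup T] (β : BimulForm X T) where
  fst : X
  snd : T

namespace BimulForm.Ext

variable {X T : Type*} [Group X] [AddCommGroup T] {β : BimulForm X T}

instance : Mul β.Ext := ⟨fun a b => ⟨a.fst * b.fst, a.snd + b.snd + β a.fst b.fst⟩⟩
instance : One β.Ext := ⟨⟨1, 0⟩⟩
instance : Inv β.Ext := ⟨fun a => ⟨a.fst⁻¹, -a.snd + β a.fst a.fst⟩⟩

@[simp] theorem mul_fst (a b : β.Ext) : (a * b).fst = a.fst * b.fst := rfl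
@[simp] theorem mul_snd (a b : β.Ext) : (a * b).snd = a.snd + b.snd + β a.fst b.fst := rfl
@[simp] theorem one_fst : (1 : β.Ext).fst = 1 := rfl
@[simp] theorem one_snd : (1 : β.Ext).snd = 0 := rfl
@[simp] theorem inv_fst (a : β.Ext) : a⁻¹.fst = a.fst⁻¹ := rfl
@[simp] theorem inv_snd (a : β.Ext) : a⁻¹.snd = -a.snd + β a.fst a.fst := rfl

instance : Group β.Ext := Group.ofLeftAxioms
  (fun a b c => by
    ext
    · simp [mul_assoc]
    · simp only [mul_snd, mul_fst, β.map_mul_left, β.map_mul_right]; abel)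
  (fun a => by ext <;> simp)
  (fun a => by ext <;> simp)

/-- The projection of the extension onto `X`. -/
def proj : β.Ext →* X := MonoidHom.mk' fst fun _ _ => rfl

/-- The inclusion of the central subgroup `T`. -/
def incl : Multiplicative T →* β.Ext :=
  MonoidHom.mk' (fun t => ⟨1, t.toAdd⟩) fun t s => by ext <;> simp

theorem commutator_eq (a b : β.Ext) :
    ⁅a, b⁆ = ⟨⁅a.fst, b.fst⁆, β a.fst b.fst - β b.fst a.fst⟩ := by
  have hc : ⁅a.fst, b.fst⁆ ∈ commutator X :=
    Subgroup.commutator_mem_commutator (Subgroup.mem_top _) (Subgroup.mem_top _)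
  have h' : ⁅a.fst, b.fst⁆ * b.fst * a.fst = a.fst * b.fst := by
    rw [commutatorElement_def]; group
  rw [commutatorElement_def, mul_inv_eq_iff_eq_mul, mul_inv_eq_iff_eq_mul]
  ext
  · simp [h']
  · simp only [mul_snd, mul_fst, β.map_mul_left, β.commutator_left hc]; abel

theorem pow_eq (a : β.Ext) (m : ℕ) :
    a ^ m = ⟨a.fst ^ m, m • a.snd + (m.choose 2) • β a.fst a.fst⟩ := by
  induction m with
  | zero => ext <;> simp
  | succ m ih =>
    rw [pow_succ, ih]
    ext
    · simp [pow_succ]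
    · simp only [mul_snd, pow_left, Nat.choose_succ_succ' m 1, Nat.choose_one_right, add_smul,
        one_smul]
      abel

theorem nilTwo (hX : NilTwo X) : NilTwo β.Ext := by
  intro a ha
  have h1 : a.fst ∈ commutator X := map_mem_commutator proj ha
  rw [Subgroup.mem_center_iff]
  intro b
  ext
  · exact Subgroup.mem_center_iff.mp (hX h1) b.fst
  · simp only [mul_snd, β.commutator_left h1, β.commutator_right h1]; abel

theorem nilTwoExponent {k : ℕ} (hk : Odd k) (hX : NilTwoExponent k X) (hT : ∀ t : T, k • t = 0) :
    NilTwoExponent k β.Ext := by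
  refine ⟨nilTwo hX.1, fun a => ?_⟩
  obtain ⟨m, rfl⟩ := hk
  -- For odd `k` the binomial coefficient in the power formula is a multiple of `k`, so the cocycle
  -- does not raise the exponent.
  have hc : (2 * m + 1).choose 2 = m * (2 * m + 1) := by
    rw [Nat.choose_two_right, Nat.add_sub_cancel,
      show (2 * m + 1) * (2 * m) = 2 * (m * (2 * m + 1)) by ring, Nat.mul_div_cancel_left _ two_pos]
  rw [pow_eq, hc, mul_smul, hT, hT, smul_zero, add_zero, hX.2]
  rfl

end BimulForm.Ext

section NilTwo

variable {A : Type*} [Group A]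

theorem NilTwo.commutatorElement_mem_center (hA : NilTwo A) (x y : A) :
    ⁅x, y⁆ ∈ Subgroup.center A :=
  hA (Subgroup.commutator_mem_commutator (Subgroup.mem_top _) (Subgroup.mem_top _))

theorem NilTwo.mul_commutatorElement (hA : NilTwo A) (x y z : A) :
    ⁅x * y, z⁆ = ⁅x, z⁆ * ⁅y, z⁆ := by
  have h := Subgroup.mem_center_iff.mp (hA.commutatorElement_mem_center y z) x
  calc ⁅x * y, z⁆ = x * ⁅y, z⁆ * (z * x⁻¹ * z⁻¹) := by simp only [commutatorElement_def]; group
    _ = ⁅y, z⁆ * ⁅x, z⁆ := by rw [h]; simp only [commutatorElement_def]; group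
    _ = ⁅x, z⁆ * ⁅y, z⁆ :=
      (Subgroup.mem_center_iff.mp (hA.commutatorElement_mem_center y z) _).symm

theorem NilTwo.commutatorElement_mul (hA : NilTwo A) (x y z : A) :
    ⁅x, y * z⁆ = ⁅x, y⁆ * ⁅x, z⁆ := by
  rw [← commutatorElement_inv, hA.mul_commutatorElement, mul_inv_rev, commutatorElement_inv,
    commutatorElement_inv]
  exact Subgroup.mem_center_iff.mp (hA.commutatorElement_mem_center x y) _

theorem NilTwo.pow_commutatorElement (hA : NilTwo A) (x y : A) (q : ℕ) :
    ⁅x ^ q, y⁆ = ⁅x, y⁆ ^ q := by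
  induction q with
  | zero => simp
  | succ q ih => rw [pow_succ, hA.mul_commutatorElement, ih, pow_succ]

theorem NilTwo.commutatorElement_pow (hA : NilTwo A) (x y : A) (q : ℕ) :
    ⁅x, y ^ q⁆ = ⁅x, y⁆ ^ q := by
  rw [← commutatorElement_inv, hA.pow_commutatorElement, ← inv_pow, commutatorElement_inv]

/-- The form obtained from commutators and a homomorphism on the center. -/
def NilTwo.commutatorForm {T : Type*} [AddCommGroup T] (hA : NilTwo A)
    (χ : Additive (Subgroup.center A) →+ T) : BimulForm A T where
  toFun x y := χ (Additive.ofMul ⟨⁅x, y⁆, hA.commutatorElement_mem_center x y⟩)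
  map_mul_left x x' y := by
    rw [← map_add, ← ofMul_mul]
    congr 2
    exact Subtype.ext (hA.mul_commutatorElement x x' y)
  map_mul_right x y y' := by
    rw [← map_add, ← ofMul_mul]
    congr 2
    exact Subtype.ext (hA.commutatorElement_mul x y y')

end NilTwo

/-! ### Separating homomorphisms -/

/-- The homomorphism from a group to its abelianization, written additively. -/
def toAb (A : Type*) [Group A] : Additive A →+ Additive (Abelianization A) :=
  MonoidHom.toAdditive Abelianization.of

/-- A bimultiplicative form descends to the abelianization. -/
def BimulForm.onAb {A T : Type*} [Group A] [AddCommGroup T] (β : BimulForm A T) :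
    Additive (Abelianization A) →+ Additive (Abelianization A) →+ T :=
  MonoidHom.toAdditiveLeft (Abelianization.lift
    (MonoidHom.mk' (fun x => Multiplicative.ofAdd
      (MonoidHom.toAdditiveLeft (Abelianization.lift (β.right x)))) fun x x' => by
        rw [← ofAdd_add]
        congr 1
        ext y
        exact β.map_mul_left x x' y))

theorem BimulForm.onAb_apply {A T : Type*} [Group A] [AddCommGroup T] (β : BimulForm A T)
    (x y : A) : β.onAb (.ofMul (Abelianization.of x)) (.ofMul (Abelianization.of y)) = β x y := rfl

theorem Abelianization.of_eq_of_iff {A : Type*} [Group A] {x y : A} :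
    Abelianization.of x = Abelianization.of y ↔ ∃ c ∈ commutator A, x * c = y := by
  refine QuotientGroup.eq.trans ⟨fun h => ⟨_, h, by simp⟩, ?_⟩
  rintro ⟨c, hc, rfl⟩
  simpa using hc

/-- A subgroup of the cocycle extension that contains the commutators and meets the central
subgroup trivially is killed by a retraction onto the central subgroup. -/
theorem BimulForm.Ext.exists_retraction {A : Type*} [Group A] {k : ℕ}
    {β : BimulForm A (CircleTorsion k)} (hE : ∀ e : β.Ext, e ^ k = 1) (N : Subgroup β.Ext)
    (hc : commutator β.Ext ≤ N) (hN : ∀ t, BimulForm.Ext.incl (β := β) t ∈ N → t = 1) :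
    ∃ R : β.Ext →* Multiplicative (CircleTorsion k), (∀ t, R (incl t) = t) ∧ ∀ e ∈ N, R e = 1 := by
  let N' : AddSubgroup (Additive (Abelianization β.Ext)) :=
    (N.map Abelianization.of).toAddSubgroup
  let Y := Additive (Abelianization β.Ext) ⧸ N'
  let j : β.Ext →* Multiplicative Y := AddMonoidHom.toMultiplicative
    (α := Additive β.Ext) ((QuotientAddGroup.mk' N').comp (toAb β.Ext))
  have hj : ∀ e, j e = 1 → e ∈ N := fun e he => by
    obtain ⟨e', he', h⟩ := (QuotientAddGroup.eq_zero_iff _).mp he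
    obtain ⟨c, hcc, rfl⟩ := Abelianization.of_eq_of_iff.mp h
    exact N.mul_mem he' (hc hcc)
  have hY : ∀ y : Y, k • y = 0 := fun y => by
    induction y using QuotientAddGroup.induction_on with
    | H u =>
      induction u using Additive.rec with
      | ofMul u =>
        obtain ⟨e, rfl⟩ := QuotientGroup.mk_surjective u
        change j e ^ k = 1
        rw [← map_pow, hE, map_one]
  -- The central subgroup injects into the abelian quotient by `N`, so its identity map extends to
  -- that quotient.
  obtain ⟨ρ, hρ⟩ := CircleTorsion.exists_extension hY
    (MonoidHom.toAdditive (j.comp incl) : CircleTorsion k →+ Y) (AddMonoidHom.id _)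
    fun t ht => hN (.ofAdd t) (hj _ ht)
  refine ⟨(AddMonoidHom.toMultiplicative ρ).comp j, fun t => hρ t.toAdd, fun e he => ?_⟩
  have : j e = 1 := (QuotientAddGroup.eq_zero_iff _).mpr ⟨e, he, rfl⟩
  rw [MonoidHom.comp_apply, this, map_one]

/-- A form that antisymmetrizes to the commutator form of `χ` is the coboundary of a function that
restricts to `χ` on commutators. -/
theorem NilTwo.exists_coboundary {A : Type*} [Group A] {k : ℕ} (hk : Odd k)
    (hA : NilTwoExponent k A) (B : Subgroup A)
    (χ : Additive (Subgroup.center A) →+ CircleTorsion k)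
    (hχ : ∀ z : Subgroup.center A, (z : A) ∈ B → χ (.ofMul z) = 0)
    (β : BimulForm A (CircleTorsion k)) (hβB : ∀ b ∈ B, ∀ b' ∈ B, β b b' = 0)
    (hβ : ∀ x y, β x y - β y x = hA.1.commutatorForm χ x y) :
    ∃ δ : A → CircleTorsion k, (∀ x y, δ (x * y) = δ x + δ y + β x y) ∧ (∀ b ∈ B, δ b = 0) ∧
      ∀ z : Subgroup.center A, (z : A) ∈ commutator A → δ z = χ (.ofMul z) := by
  have hE := BimulForm.Ext.nilTwoExponent (β := β) hk hA CircleTorsion.nsmul_eq_zero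
  -- The lift of `B A'` on which `δ` is prescribed: zero on `B`, `χ` on commutators. A retraction
  -- trivial on `N` encodes these values.
  let N : Subgroup β.Ext :=
    { carrier := {e | ∃ b ∈ B, ∃ z : Subgroup.center A, (z : A) ∈ commutator A ∧
        e = ⟨b * z, χ (.ofMul z)⟩}
      one_mem' := ⟨1, B.one_mem, 1, Subgroup.one_mem _, by ext <;> simp⟩
      mul_mem' := by
        rintro _ _ ⟨b, hb, z, hz, rfl⟩ ⟨b', hb', z', hz', rfl⟩
        refine ⟨b * b', B.mul_mem hb hb', z * z', Subgroup.mul_mem _ hz hz', ?_⟩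
        ext
        · have := Subgroup.mem_center_iff.mp z.2 b'
          simp only [BimulForm.Ext.mul_fst, Subgroup.coe_mul]
          rw [mul_assoc, ← mul_assoc (z : A), ← this]
          simp only [mul_assoc]
        · simp only [BimulForm.Ext.mul_snd, ofMul_mul, map_add, β.map_mul_left, β.map_mul_right,
            β.commutator_left hz, β.commutator_right hz', hβB b hb b' hb']
          simp
      inv_mem' := by
        rintro _ ⟨b, hb, z, hz, rfl⟩
        refine ⟨b⁻¹, B.inv_mem hb, z⁻¹, Subgroup.inv_mem _ hz, ?_⟩
        ext
        · have := Subgroup.mem_center_iff.mp (z⁻¹).2 b⁻¹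
          simp only [BimulForm.Ext.inv_fst, mul_inv_rev, this]
          rfl
        · simp only [BimulForm.Ext.inv_snd, ofMul_inv, map_neg, β.map_mul_left, β.map_mul_right,
            β.commutator_left hz, β.commutator_right hz, hβB b hb b hb]
          simp }
  have hNz : ∀ z : Subgroup.center A, (z : A) ∈ commutator A →
      (⟨z, χ (.ofMul z)⟩ : β.Ext) ∈ N := fun z hz => ⟨1, B.one_mem, z, hz, by rw [one_mul]⟩
  obtain ⟨R, hR, hRN⟩ := BimulForm.Ext.exists_retraction hE.2 N
    (by
      rw [commutator_def, Subgroup.commutator_le]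
      intro a _ b _
      rw [BimulForm.Ext.commutator_eq, hβ]
      exact hNz ⟨_, hA.1.commutatorElement_mem_center a.fst b.fst⟩
        (Subgroup.commutator_mem_commutator (Subgroup.mem_top _) (Subgroup.mem_top _)))
    (by
      rintro t ⟨b, hb, z, hz, h⟩
      have h1 : 1 = b * (z : A) := congrArg BimulForm.Ext.fst h
      have h2 : t.toAdd = χ (.ofMul z) := congrArg BimulForm.Ext.snd h
      rw [hχ z (by rw [← inv_eq_of_mul_eq_one_right h1.symm]; exact B.inv_mem hb)] at h2
      exact h2)
  have hsplit : ∀ (x : A) (t : CircleTorsion k),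
      R ⟨x, t⟩ = R ⟨x, 0⟩ * Multiplicative.ofAdd t := fun x t => by
    rw [← hR (.ofAdd t), ← map_mul]
    congr 1
    ext
    · exact (mul_one x).symm
    · simp [BimulForm.Ext.incl]
  -- The sign comes from `(x, 0)(y, 0) = (xy, β x y)`; it also turns `R (z, χ z) = 1` into `δ z = χ
  -- z`.
  refine ⟨fun x => -(R ⟨x, 0⟩).toAdd, fun x y => ?_, fun b hb => ?_, fun z hz => ?_⟩
  · have h := hsplit (x * y) (β x y)
    have h2 : (⟨x * y, β x y⟩ : β.Ext) = ⟨x, 0⟩ * ⟨y, 0⟩ := by ext <;> simp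
    rw [h2, map_mul] at h
    have h3 := congrArg Multiplicative.toAdd h
    simp only [toAdd_mul, toAdd_ofAdd] at h3
    rw [← sub_eq_iff_eq_add] at h3
    beta_reduce
    rw [← h3]; abel
  · have : (⟨b, 0⟩ : β.Ext) ∈ N := ⟨b, hb, 1, Subgroup.one_mem _, by ext <;> simp⟩
    beta_reduce
    rw [hRN _ this]; simp
  · have h := hsplit z (χ (.ofMul z))
    rw [hRN _ (hNz z hz)] at h
    have h3 := congrArg Multiplicative.toAdd h
    simp only [toAdd_mul, toAdd_ofAdd, toAdd_one] at h3
    exact neg_eq_of_add_eq_zero_right h3.symm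

open scoped IsMulCommutative in
theorem CircleTorsion.exists_ne_zero_of_notMem {C : Type*} [Group C] [IsMulCommutative C] {k : ℕ}
    (hC : ∀ c : C, c ^ k = 1) (S : Subgroup C) {c : C} (hc : c ∉ S) :
    ∃ χ : Additive C →+ CircleTorsion k, (∀ z ∈ S, χ (.ofMul z) = 0) ∧ χ (.ofMul c) ≠ 0 := by
  obtain ⟨χ, hχ⟩ := CircleTorsion.exists_ne_zero (k := k) (Y := Additive C ⧸ S.toAddSubgroup)
    (fun y => by
      obtain ⟨w, rfl⟩ := QuotientAddGroup.mk_surjective y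
      rw [← QuotientAddGroup.mk_nsmul]
      have : k • w = 0 := hC w.toMul
      rw [this]; rfl)
    (y := ((Additive.ofMul c : Additive C) : _ ⧸ S.toAddSubgroup))
    (fun h => hc ((QuotientAddGroup.eq_zero_iff _).mp h))
  refine ⟨χ.comp (QuotientAddGroup.mk' _), fun z hz => ?_, hχ⟩
  have : ((Additive.ofMul z : Additive C) : _ ⧸ S.toAddSubgroup) = 0 :=
    (QuotientAddGroup.eq_zero_iff _).mpr hz
  rw [AddMonoidHom.comp_apply, QuotientAddGroup.mk'_apply, this, map_zero]

/-- If `[r, s]^q ∈ B` whenever `r^q` and `s^q` lie in `B` modulo commutators, then two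
homomorphisms that agree on `B` separate any element outside `B`. -/
theorem NilTwoExponent.exists_separating_homs {A : Type u} [Group A] {k : ℕ} (hk : Odd k)
    (hA : NilTwoExponent k A) (B : Subgroup A)
    (hB : ∀ (χ : Additive (Subgroup.center A) →+ CircleTorsion k),
      (∀ z : Subgroup.center A, (z : A) ∈ B → χ (.ofMul z) = 0) → ∀ (q : ℕ) (r s : A),
      (∃ b ∈ B, Abelianization.of (r ^ q) = Abelianization.of b) →
      (∃ b ∈ B, Abelianization.of (s ^ q) = Abelianization.of b) →
      q • hA.1.commutatorForm χ r s = 0) (a : A) (ha : a ∉ B) :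
    ∃ (M : Type u) (_ : Group M) (f g : A →* M), NilTwoExponent k M ∧ (∀ b ∈ B, f b = g b) ∧
      f a ≠ g a := by
  let U := Additive (Abelianization A)
  let π : A → U := fun x => .ofMul (Abelianization.of x)
  have hπs : Function.Surjective π := fun u => QuotientGroup.mk_surjective u.toMul
  have hπ : ∀ x y, π (x * y) = π x + π y := fun x y => rfl
  have hπp : ∀ x (q : ℕ), π (x ^ q) = q • π x := fun x q => rfl
  have hU : ∀ u : U, k • u = 0 := fun u => by
    obtain ⟨x, rfl⟩ := hπs u
    rw [← hπp, hA.2]; rfl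
  let B' : AddSubgroup U := (B.map Abelianization.of).toAddSubgroup
  have hB' : ∀ b ∈ B, π b ∈ B' := fun b hb => ⟨b, hb, rfl⟩
  let V := U ⧸ B'
  have hV : ∀ v : Multiplicative V, v ^ k = 1 := fun v => by
    obtain ⟨u, hu⟩ := QuotientAddGroup.mk_surjective v.toAdd
    change k • v.toAdd = 0
    rw [← hu, ← QuotientAddGroup.mk_nsmul, hU]; rfl
  let σ : A →* Multiplicative V := MonoidHom.mk' (fun x => .ofAdd (π x : V)) fun x y => rfl
  have hσ : ∀ b ∈ B, σ b = 1 := fun b hb => (QuotientAddGroup.eq_zero_iff _).mpr (hB' b hb)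
  by_cases hσa : σ a = 1
  -- Outside `B A'` the quotient map to `V` and the trivial map already separate.
  swap
  · exact ⟨Multiplicative V, inferInstance, σ, 1, ⟨NilTwo.of_comm, hV⟩, fun b hb => hσ b hb, hσa⟩
  obtain ⟨b₀, hb₀, h₀⟩ := (QuotientAddGroup.eq_zero_iff _).mp hσa
  obtain ⟨c, hc, rfl⟩ := Abelianization.of_eq_of_iff.mp h₀
  let z : Subgroup.center A := ⟨c, hA.1 hc⟩
  have hcB : c ∉ B := fun h => ha (B.mul_mem hb₀ h)
  obtain ⟨χ, hχ, hχz⟩ := CircleTorsion.exists_ne_zero_of_notMem (k := k)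
    (fun w : Subgroup.center A => Subtype.ext (hA.2 (w : A))) (B.subgroupOf (Subgroup.center A))
    (c := z) hcB
  let κ := hA.1.commutatorForm χ
  have hκB : ∀ b ∈ B, ∀ b' ∈ B, κ b b' = 0 := fun b hb b' hb' => hχ _ <| by
    change ⁅b, b'⁆ ∈ B
    rw [commutatorElement_def]
    exact B.mul_mem (B.mul_mem (B.mul_mem hb hb') (B.inv_mem hb)) (B.inv_mem hb')
  obtain ⟨β, hβ, hβκ⟩ := exists_bilinear_splitting hk hU B' κ.onAb
    (fun u => by
      obtain ⟨x, rfl⟩ := hπs u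
      refine hχ _ ?_
      change ⁅x, x⁆ ∈ B
      rw [commutatorElement_self]; exact B.one_mem)
    (by
      rintro _ ⟨b, hb, rfl⟩ _ ⟨b', hb', rfl⟩
      exact hκB b hb b' hb')
    (fun q u v => by
      obtain ⟨r, rfl⟩ := hπs u
      obtain ⟨s, rfl⟩ := hπs v
      rintro ⟨b, hb, hbr⟩ ⟨b', hb', hbs⟩
      exact hB χ hχ q r s ⟨b, hb, hbr.symm⟩ ⟨b', hb', hbs.symm⟩)
  let βA : BimulForm A (CircleTorsion k) :=
    { toFun := fun x y => β (π x) (π y)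
      map_mul_left := fun x x' y => by rw [hπ, map_add]; rfl
      map_mul_right := fun x y y' => by rw [hπ, map_add] }
  obtain ⟨δ, hδ, hδB, hδχ⟩ := NilTwo.exists_coboundary hk hA B χ hχ βA
    (fun b _ b' hb' => hβ _ _ (hB' b' hb')) fun x y => hβκ (π x) (π y)
  let βV : V →+ U →+ CircleTorsion k := QuotientAddGroup.lift B' β.flip fun b hb =>
    DFunLike.ext _ _ fun u => hβ u b hb
  -- This cocycle is trivial on the graph of the trivial map and restricts to `βA` on the graph of
  -- `σ`, so `0` and `δ` respectively lift the two graphs to homomorphisms.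
  let βM : BimulForm (A × Multiplicative V) (CircleTorsion k) :=
    { toFun := fun x y => βV y.2.toAdd (π x.1)
      map_mul_left := fun x x' y => by rw [Prod.fst_mul, hπ, map_add]
      map_mul_right := fun x y y' => by rw [Prod.snd_mul, toAdd_mul, map_add]; rfl }
  let f : A →* βM.Ext := MonoidHom.mk' (fun x => ⟨(x, 1), 0⟩) fun x y => by
    ext
    · rfl
    · simp
    · have : βM (x, 1) (y, 1) = 0 := by
        change βV 0 (π x) = 0
        rw [map_zero]; rfl
      simp [this]
  let g : A →* βM.Ext := MonoidHom.mk' (fun x => ⟨(x, σ x), δ x⟩) fun x y => by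
    ext
    · rfl
    · simp
    · simp only [BimulForm.Ext.mul_snd, hδ]
      rfl
  refine ⟨βM.Ext, inferInstance, f, g, BimulForm.Ext.nilTwoExponent hk
    (hA.prod ⟨NilTwo.of_comm, hV⟩) CircleTorsion.nsmul_eq_zero, fun b hb => ?_, fun h => ?_⟩
  · ext
    · rfl
    · exact congrArg Multiplicative.toAdd (hσ b hb).symm
    · exact congrArg Subtype.val (hδB b hb).symm
  · have h1 : 0 = δ (b₀ * c) := congrArg BimulForm.Ext.snd h
    rw [hδ, hδB b₀ hb₀, βA.commutator_right hc, zero_add, add_zero] at h1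
    exact hχz ((hδχ z hc).symm.trans h1.symm)

/-! ### Sufficient conditions for absolute closure -/

/-- A sufficient condition for absolute closure: whenever `r^q` and `s^q` lie in `G` modulo
commutators, they are powers of one element modulo commutators, or `r` and `s` lie in `G` modulo
commutators. -/
theorem absolutelyClosed_of_powers {G : Type u} [Group G] {k : ℕ} (hk : Odd k)
    (hG : NilTwoExponent k G)
    (h : ∀ (A : Type u) [Group A], NilTwoExponent k A → ∀ Φ : G →* A, Function.Injective Φ →
      ∀ (q : ℕ) (r s : A) (g g' : G), Abelianization.of (r ^ q) = Abelianization.of (Φ g) →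
        Abelianization.of (s ^ q) = Abelianization.of (Φ g') →
        (∃ (z : A) (a b : ℤ), Abelianization.of (r ^ q) = Abelianization.of (z ^ a) ∧
          Abelianization.of (s ^ q) = Abelianization.of (z ^ b)) ∨
        (∃ r' s' : G, Abelianization.of r = Abelianization.of (Φ r') ∧
          Abelianization.of s = Abelianization.of (Φ s'))) :
    AbsolutelyClosed (NilTwoExponent.{u} k) G := by
  refine ⟨hG, fun A A' _ _ hA hA' Φ Φ' hΦ hΦ' ⟨ψ, hψ⟩ => ?_⟩
  have hsep := NilTwoExponent.exists_separating_homs hk hA Φ.range fun χ hχ q r s hr hs => by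
    obtain ⟨_, ⟨g, rfl⟩, hr⟩ := hr
    obtain ⟨_, ⟨g', rfl⟩, hs⟩ := hs
    have halt : ∀ x, hA.1.commutatorForm χ x x = 0 := fun x => hχ _ <| by
      change ⁅x, x⁆ ∈ Φ.range
      rw [commutatorElement_self]; exact Subgroup.one_mem _
    obtain ⟨z, a, b, ha, hb⟩ | ⟨r', s', hr', hs'⟩ := h A hA Φ hΦ q r s g g' hr hs
    · rw [← BimulForm.onAb_apply]
      refine nsmul_alternating_eq_zero _ (fun u => ?_) q _ _ (.ofMul (Abelianization.of z)) a b
        (congrArg Additive.ofMul (show Abelianization.of r ^ q = Abelianization.of z ^ a by rw [← map_pow, ha, map_zpow]))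
        (congrArg Additive.ofMul (show Abelianization.of s ^ q = Abelianization.of z ^ b by rw [← map_pow, hb, map_zpow]))
      obtain ⟨x, hx⟩ := QuotientGroup.mk_surjective u.toMul
      have : u = .ofMul (Abelianization.of x) := congrArg Additive.ofMul hx.symm
      rw [this, BimulForm.onAb_apply, halt]
    · rw [← BimulForm.onAb_apply, hr', hs', BimulForm.onAb_apply]
      refine (congrArg (q • ·) (hχ _ ?_)).trans (smul_zero _)
      exact ⟨⁅r', s'⁆, map_commutatorElement Φ r' s'⟩
  choose M inst f g hM hfg hne using hsep
  -- The identity factor makes both maps injective and reduces any identification to a single `a`,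
  -- which its own factor of `P` rules out.
  let P := ∀ i : {a // a ∉ Φ.range}, M i.1 i.2
  let F : A →* P := MonoidHom.pi fun i => f i.1 i.2
  let F' : A →* P := MonoidHom.pi fun i => g i.1 i.2
  refine ⟨A × P, inferInstance, (MonoidHom.id A).prod F,
    ((MonoidHom.id A).prod F').comp ψ.symm.toMonoidHom,
    hA.prod (NilTwoExponent.pi fun i => hM i.1 i.2), fun a b hab => congrArg Prod.fst hab,
    fun a b hab => ψ.symm.injective (congrArg Prod.fst hab), ?_, fun a c ha _ hac => ?_⟩
  · ext1 x
    have hx : ψ.symm (Φ' x) = Φ x := by rw [← hψ]; exact ψ.symm_apply_apply _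
    change (Φ x, F (Φ x)) = (ψ.symm (Φ' x), F' (ψ.symm (Φ' x)))
    rw [hx]
    exact Prod.ext rfl (funext fun i => hfg i.1 i.2 _ ⟨x, rfl⟩)
  · have h1 : a = ψ.symm c := congrArg Prod.fst hac
    have h2 : F a = F' (ψ.symm c) := congrArg Prod.snd hac
    rw [← h1] at h2
    exact hne a ha (congrFun h2 ⟨a, ha⟩)

/-- Cyclic groups are absolutely closed. -/
theorem absolutelyClosed_of_isCyclic {G : Type u} [Group G] {k : ℕ} (hk : Odd k)
    (hG : NilTwoExponent k G) (hc : IsCyclic G) :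
    AbsolutelyClosed (NilTwoExponent.{u} k) G := by
  refine absolutelyClosed_of_powers hk hG fun A _ hA Φ _ q r s g g' hr hs => Or.inl ?_
  obtain ⟨z, hz⟩ := hc.exists_generator
  obtain ⟨a, rfl⟩ := hz g
  obtain ⟨b, rfl⟩ := hz g'
  exact ⟨Φ z, a, b, by rw [hr]; simp, by rw [hs]; simp⟩

/-- The quotient of the center by the commutator subgroup is cyclic if and only if the image of the
center in the abelianization is. -/
theorem isCyclic_center_quotient_iff {G : Type*} [Group G] :
    IsCyclic (Subgroup.center G ⧸ (commutator G).subgroupOf (Subgroup.center G)) ↔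
      ∃ z ∈ Subgroup.center G, ∀ y ∈ Subgroup.center G,
        ∃ a : ℤ, Abelianization.of y = Abelianization.of (z ^ a) := by
  have key : ∀ (z y : Subgroup.center G) (a : ℤ),
      ((z : Subgroup.center G ⧸ (commutator G).subgroupOf (Subgroup.center G)) ^ a = y) ↔
        Abelianization.of (y : G) = Abelianization.of ((z : G) ^ a) := fun z y a => by
    rw [← QuotientGroup.mk_zpow, QuotientGroup.eq, Subgroup.mem_subgroupOf, eq_comm]
    exact QuotientGroup.eq.symm
  constructor
  · intro h
    obtain ⟨w, hw⟩ := h.exists_generator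
    obtain ⟨z, rfl⟩ := QuotientGroup.mk_surjective w
    refine ⟨z, z.2, fun y hy => ?_⟩
    obtain ⟨a, ha⟩ := hw ((⟨y, hy⟩ : Subgroup.center G) : _ ⧸ _)
    exact ⟨a, (key z ⟨y, hy⟩ a).mp ha⟩
  · rintro ⟨z, hz, h⟩
    refine ⟨⟨((⟨z, hz⟩ : Subgroup.center G) : _ ⧸ _), fun w => ?_⟩⟩
    obtain ⟨y, rfl⟩ := QuotientGroup.mk_surjective w
    obtain ⟨a, ha⟩ := h y y.2
    exact ⟨a, (key ⟨z, hz⟩ y a).mpr ha⟩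

theorem NilTwo.mul_commutatorElement_of_mem {A : Type*} [Group A] (hA : NilTwo A) (x y : A) {c : A}
    (hc : c ∈ commutator A) : ⁅x * c, y⁆ = ⁅x, y⁆ := by
  rw [hA.mul_commutatorElement, commutatorElement_eq_one_iff_mul_comm.mpr
    (Subgroup.mem_center_iff.mp (hA hc) y).symm, mul_one]

/-- If `p ∣ q`, then `[r^q, x] = [r, x^q] = 1` for `x` in `G`, so the powers come from the center.
If `p ∤ q`, then `q` is invertible modulo `p ^ n` and roots stay in `G` modulo commutators. -/
theorem absolutelyClosed_of_center_quotient {p n : ℕ} (hp : p.Prime) (hodd : Odd p) {G : Type u}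
    [Group G] (hG : NilTwoExponent (p ^ n) G) (hGp : ExponentVariety p G)
    (hc : IsCyclic (Subgroup.center G ⧸ (commutator G).subgroupOf (Subgroup.center G))) :
    AbsolutelyClosed (NilTwoExponent.{u} (p ^ n)) G := by
  refine absolutelyClosed_of_powers hodd.pow hG fun A _ hA Φ hΦ q r s g g' hr hs => ?_
  by_cases hpq : p ∣ q
  · left
    have hcen : ∀ (r : A) (g : G), Abelianization.of (r ^ q) = Abelianization.of (Φ g) →
        g ∈ Subgroup.center G := fun r g hr => by
      obtain ⟨c, hc, hrc⟩ := Abelianization.of_eq_of_iff.mp hr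
      rw [Subgroup.mem_center_iff]
      intro x
      refine (commutatorElement_eq_one_iff_mul_comm.mp (hΦ ?_)).symm
      obtain ⟨m, rfl⟩ := hpq
      rw [map_commutatorElement, ← hrc, hA.1.mul_commutatorElement_of_mem _ _ hc,
        hA.1.pow_commutatorElement, ← hA.1.commutatorElement_pow, ← map_pow, pow_mul, hGp, one_pow]
      simp
    obtain ⟨z, hz, h⟩ := isCyclic_center_quotient_iff.mp hc
    have hmap : ∀ g ∈ Subgroup.center G, ∃ a : ℤ,
        Abelianization.of (Φ g) = Abelianization.of (Φ z ^ a) := fun g hg => by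
      obtain ⟨a, ha⟩ := h g hg
      refine ⟨a, ?_⟩
      have := congrArg (Abelianization.map Φ) ha
      rwa [Abelianization.map_of, Abelianization.map_of, map_zpow] at this
    obtain ⟨a, ha⟩ := hmap g (hcen r g hr)
    obtain ⟨b, hb⟩ := hmap g' (hcen s g' hs)
    exact ⟨Φ z, a, b, hr.trans ha, hs.trans hb⟩
  · right
    have hcop : Nat.Coprime q (p ^ n) :=
      Nat.Coprime.pow_right n ((hp.coprime_iff_not_dvd.mpr hpq).symm)
    have hroot : ∀ (r : A) (g : G), Abelianization.of (r ^ q) = Abelianization.of (Φ g) →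
        ∃ g₁, Abelianization.of r = Abelianization.of (Φ g₁) := fun r g hr => by
      obtain ⟨m, hm⟩ := exists_pow_eq_self_of_coprime
        (hcop.coprime_dvd_right (orderOf_dvd_of_pow_eq_one (hA.2 r)))
      exact ⟨g ^ m, by rw [map_pow Φ, map_pow Abelianization.of, ← hr, ← map_pow, hm]⟩
    obtain ⟨r', hr'⟩ := hroot r g hr
    obtain ⟨s', hs'⟩ := hroot s g' hs
    exact ⟨r', s', hr', hs'⟩

/-! ### Necessary conditions: overgroups with a Heisenberg factor -/

/-- If `r^q` and `s^q` lie in the core modulo commutators, then `[r, s]^q` is not separated by any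
pair of embeddings that agree on the core. -/
theorem StronglyEmbeddable.commutator_pow_mem {k : ℕ} {A G : Type u} [Group A] [Group G]
    {Φ : G →* A} (h : StronglyEmbeddable (NilTwoExponent.{u} k) Φ Φ) (q : ℕ) {r s c d : A} {x y : G}
    (hc : c ∈ commutator A) (hd : d ∈ commutator A) (hx : r ^ q * c = Φ x) (hy : s ^ q * d = Φ y) :
    ⁅r, s⁆ ^ q ∈ Φ.range := by
  by_contra hmem
  obtain ⟨M, _, l, l', hM, -, -, hl, hne⟩ := h
  have hl' : ∀ g, l (Φ g) = l' (Φ g) := fun g => DFunLike.congr_fun hl g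
  refine hne _ _ hmem hmem ?_
  have hpow : ∀ (f : A →* M) (t : M) (r c : A) (x : G), c ∈ commutator A → r ^ q * c = Φ x →
      ⁅f r, t⁆ ^ q = ⁅f (Φ x), t⁆ := fun f t r c x hc hx => by
    rw [← hx, map_mul, map_pow, hM.1.mul_commutatorElement_of_mem _ _ (map_mem_commutator f hc),
      hM.1.pow_commutatorElement]
  have hpow' : ∀ (f : A →* M) (t : M) (r c : A) (x : G), c ∈ commutator A → r ^ q * c = Φ x →
      ⁅t, f r⁆ ^ q = ⁅t, f (Φ x)⁆ := fun f t r c x hc hx => by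
    rw [← commutatorElement_inv, inv_pow, hpow f t r c x hc hx, commutatorElement_inv]
  -- One argument of the commutator is switched from `l` to `l'` at a time, each time by moving the
  -- exponent `q` onto it.
  rw [map_pow, map_pow, map_commutatorElement, map_commutatorElement, hpow l _ r c x hc hx, hl',
    ← hpow l' _ r c x hc hx, hpow' l _ s d y hd hy, hl', ← hpow' l' _ s d y hd hy]

/-- The form on `(ZMod m)²` whose extension is the Heisenberg group over `ZMod m`. -/
def heisenbergForm (m : ℕ) :
    BimulForm (Multiplicative (ZMod m) × Multiplicative (ZMod m)) (ZMod m) where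
  toFun x y := x.1.toAdd * y.2.toAdd
  map_mul_left _ _ _ := add_mul _ _ _
  map_mul_right _ _ _ := mul_add _ _ _

/-- The Heisenberg group over `ZMod m`. -/
abbrev HeisenbergZMod (m : ℕ) : Type := (heisenbergForm m).Ext

theorem HeisenbergZMod.nilTwoExponent {m k : ℕ} (hk : Odd k) (hm : m ∣ k) :
    NilTwoExponent k (HeisenbergZMod m) := by
  have h : ∀ t : ZMod m, k • t = 0 := fun t => by
    rw [nsmul_eq_mul, (ZMod.natCast_eq_zero_iff k m).mpr hm, zero_mul]
  exact BimulForm.Ext.nilTwoExponent hk ⟨NilTwo.of_comm, fun x => Prod.ext (h _) (h _)⟩ h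

/-- Multiplication by `p` from `ZMod p` to `ZMod (p ^ 2)`. -/
def ZMod.mulPrime (p : ℕ) : ZMod p →+ ZMod (p ^ 2) :=
  ZMod.lift p ⟨zmultiplesHom _ (p : ZMod (p ^ 2)), by
    rw [zmultiplesHom_apply, natCast_zsmul, nsmul_eq_mul, ← Nat.cast_mul, ← sq, ZMod.natCast_self]⟩

theorem ZMod.mulPrime_intCast (p : ℕ) (a : ℤ) :
    ZMod.mulPrime p (a : ZMod p) = ((a * p : ℤ) : ZMod (p ^ 2)) := by
  rw [ZMod.mulPrime, ZMod.lift_coe]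
  simp

theorem ZMod.mulPrime_one (p : ℕ) : ZMod.mulPrime p 1 = p := by
  simpa using ZMod.mulPrime_intCast p 1

theorem ZMod.mulPrime_mul_mulPrime (p : ℕ) (a b : ZMod p) :
    ZMod.mulPrime p a * ZMod.mulPrime p b = 0 := by
  obtain ⟨a, rfl⟩ := ZMod.intCast_surjective a
  obtain ⟨b, rfl⟩ := ZMod.intCast_surjective b
  rw [ZMod.mulPrime_intCast, ZMod.mulPrime_intCast, ← Int.cast_mul,
    ZMod.intCast_zmod_eq_zero_iff_dvd]
  exact ⟨a * b, by push_cast; ring⟩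

theorem ZMod.mulPrime_injective {p : ℕ} (hp : p ≠ 0) : Function.Injective (ZMod.mulPrime p) := by
  rw [injective_iff_map_eq_zero]
  intro a ha
  obtain ⟨a, rfl⟩ := ZMod.intCast_surjective a
  rw [ZMod.mulPrime_intCast, ZMod.intCast_zmod_eq_zero_iff_dvd] at ha
  rw [ZMod.intCast_zmod_eq_zero_iff_dvd]
  push_cast at ha
  rw [sq] at ha
  exact Int.dvd_of_mul_dvd_mul_right (by exact_mod_cast hp) ha

/-- A group with a pair of independent homomorphisms to `ZMod p` is not absolutely closed, if the
elements dual to them map to commutators under a homomorphism that is injective on the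
intersection of the kernels. -/
theorem not_absolutelyClosed_of_dual_pair {p n : ℕ} (hp : p.Prime) (hodd : Odd p) (hn : 1 < n)
    {G W : Type u} [Group G] [Group W]
    (hW : NilTwoExponent (p ^ n) W) (ι : G →* W) (φ ψ : G →* Multiplicative (ZMod p)) (x y : G)
    (hφx : φ x = .ofAdd 1) (hφy : φ y = 1) (hψx : ψ x = 1) (hψy : ψ y = .ofAdd 1)
    (hx : ι x ∈ commutator W) (hy : ι y ∈ commutator W)
    (hinj : ∀ g, ι g = 1 → φ g = 1 → ψ g = 1 → g = 1) :
    ¬ AbsolutelyClosed (NilTwoExponent.{u} (p ^ n)) G := by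
  rintro ⟨-, hAC⟩
  let j : Multiplicative (ZMod p) →* Multiplicative (ZMod (p ^ 2)) :=
    AddMonoidHom.toMultiplicative (ZMod.mulPrime p)
  have hj : Function.Injective j := ZMod.mulPrime_injective hp.ne_zero
  have hj1 : j (.ofAdd 1) = .ofAdd (p : ZMod (p ^ 2)) := ZMod.mulPrime_one p
  -- Both coordinates are multiples of `p`, so the cocycle takes values in `p ^ 2 ℤ` and vanishes;
  -- the image therefore has central coordinate zero.
  let θ : G →* HeisenbergZMod (p ^ 2) := MonoidHom.mk' (fun g => ⟨(j (φ g), j (ψ g)), 0⟩) fun g g' => by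
    have h0 : heisenbergForm (p ^ 2) (j (φ g), j (ψ g)) (j (φ g'), j (ψ g')) = 0 :=
      ZMod.mulPrime_mul_mulPrime p (φ g).toAdd (ψ g').toAdd
    apply BimulForm.Ext.ext
    · simp
    · simp [h0]
  have hH : NilTwoExponent (p ^ n) (HeisenbergZMod (p ^ 2)) :=
    HeisenbergZMod.nilTwoExponent hodd.pow (pow_dvd_pow p hn)
  let Φ : G →* W × HeisenbergZMod (p ^ 2) := ι.prod θ
  have hΦ : Function.Injective Φ := by
    rw [injective_iff_map_eq_one]
    intro g hg
    have h2 : (j (φ g), j (ψ g)) = 1 := congrArg (fun w : W × HeisenbergZMod (p ^ 2) => w.2.fst) hg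
    exact hinj g (congrArg Prod.fst hg) (hj ((congrArg Prod.fst h2).trans j.map_one.symm))
      (hj ((congrArg Prod.snd h2).trans j.map_one.symm))
  have hemb := hAC (W × HeisenbergZMod (p ^ 2)) _ (hW.prod hH) (hW.prod hH) Φ Φ hΦ hΦ ⟨MulEquiv.refl _, rfl⟩
  let r : W × HeisenbergZMod (p ^ 2) := (1, ⟨(.ofAdd 1, 1), 0⟩)
  let s : W × HeisenbergZMod (p ^ 2) := (1, ⟨(1, .ofAdd 1), 0⟩)
  have hpow : (Multiplicative.ofAdd (1 : ZMod (p ^ 2))) ^ p = .ofAdd (p : ZMod (p ^ 2)) := by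
    rw [← ofAdd_nsmul, nsmul_one]
  have hr : r ^ p * (ι x, 1) = Φ x := by
    refine Prod.ext (by simp [r, Φ]) ?_
    change (⟨(.ofAdd 1, 1), 0⟩ : HeisenbergZMod (p ^ 2)) ^ p * 1 = ⟨(j (φ x), j (ψ x)), 0⟩
    rw [mul_one, BimulForm.Ext.pow_eq, hφx, hψx, hj1, j.map_one]
    apply BimulForm.Ext.ext
    · exact Prod.ext hpow (one_pow _)
    · simp [heisenbergForm]
  have hs : s ^ p * (ι y, 1) = Φ y := by
    refine Prod.ext (by simp [s, Φ]) ?_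
    change (⟨(1, .ofAdd 1), 0⟩ : HeisenbergZMod (p ^ 2)) ^ p * 1 = ⟨(j (φ y), j (ψ y)), 0⟩
    rw [mul_one, BimulForm.Ext.pow_eq, hφy, hψy, hj1, j.map_one]
    apply BimulForm.Ext.ext
    · exact Prod.ext (one_pow _) hpow
    · simp [heisenbergForm]
  obtain ⟨g, hg⟩ := hemb.commutator_pow_mem p
    (map_mem_commutator (MonoidHom.inl W _) hx) (map_mem_commutator (MonoidHom.inl W _) hy) hr hs
  have hcomm : (⁅r, s⁆).2 = ⟨1, 1⟩ := by
    change ⁅(⟨(.ofAdd 1, 1), 0⟩ : HeisenbergZMod (p ^ 2)), (⟨(1, .ofAdd 1), 0⟩ : HeisenbergZMod (p ^ 2))⁆ = _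
    rw [BimulForm.Ext.commutator_eq]
    apply BimulForm.Ext.ext
    · exact commutatorElement_eq_one_iff_mul_comm.mpr (mul_comm _ _)
    · simp [heisenbergForm]
  -- `[r, s]^p` has central coordinate `p`, whereas elements of the image of `G` have `0` there.
  have h0 : (0 : ZMod (p ^ 2)) = ((⁅r, s⁆ ^ p).2).snd :=
    congrArg (fun w : W × HeisenbergZMod (p ^ 2) => w.2.snd) hg
  rw [Prod.pow_snd, hcomm, BimulForm.Ext.pow_eq] at h0
  have h1 : (0 : ZMod (p ^ 2)) = (p : ZMod (p ^ 2)) := by simpa using h0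
  have h2 := (ZMod.natCast_eq_zero_iff p (p ^ 2)).mp h1.symm
  have h3 := Nat.le_of_dvd hp.pos h2
  have h4 := hp.two_le
  nlinarith

theorem exists_dual_pair_linear {K V : Type*} [Field K] [AddCommGroup V] [Module K V] {x y : V}
    (hx : x ≠ 0) (hy : ∀ a : K, y ≠ a • x) :
    ∃ g : V →ₗ[K] K × K, g x = (1, 0) ∧ g y = (0, 1) := by
  let f : K × K →ₗ[K] V := (LinearMap.toSpanSingleton K V x).coprod (LinearMap.toSpanSingleton K V y)
  have hf : LinearMap.ker f = ⊥ := by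
    rw [LinearMap.ker_eq_bot']
    rintro ⟨a, b⟩ hab
    have hab' : a • x + b • y = 0 := hab
    have hb : b = 0 := by
      by_contra hb
      apply hy (-(b⁻¹ * a))
      have h2 : b⁻¹ • (a • x + b • y) = 0 := by rw [hab', smul_zero]
      rw [smul_add, smul_smul, smul_smul, inv_mul_cancel₀ hb, one_smul] at h2
      rw [neg_smul]
      exact eq_neg_of_add_eq_zero_right h2
    have ha : a = 0 := by
      rw [hb, zero_smul, add_zero] at hab'
      exact (smul_eq_zero.mp hab').resolve_right hx
    rw [ha, hb]; rfl
  obtain ⟨g, hg⟩ := f.exists_leftInverse_of_injective hf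
  refine ⟨g, ?_, ?_⟩
  · simpa [f] using DFunLike.congr_fun hg (1, 0)
  · simpa [f] using DFunLike.congr_fun hg (0, 1)

/-- Independent elements of an elementary abelian `p`-group have dual homomorphisms. -/
theorem exists_dual_pair {p : ℕ} (hp : p.Prime) {Q : Type*} [CommGroup Q] (hQ : ∀ x : Q, x ^ p = 1)
    {x y : Q} (hx : x ≠ 1) (hy : y ∉ Subgroup.zpowers x) :
    ∃ φ ψ : Q →* Multiplicative (ZMod p), φ x = .ofAdd 1 ∧ φ y = 1 ∧ ψ x = 1 ∧ ψ y = .ofAdd 1 := by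
  have : Fact p.Prime := ⟨hp⟩
  let _ : Module (ZMod p) (Additive Q) := AddCommGroup.zmodModule fun x => hQ x.toMul
  obtain ⟨g, hgx, hgy⟩ := exists_dual_pair_linear (K := ZMod p) (x := Additive.ofMul x)
    (y := Additive.ofMul y) hx fun a ha => hy <| by
      obtain ⟨m, rfl⟩ := ZMod.intCast_surjective a
      rw [Int.cast_smul_eq_zsmul] at ha
      exact ⟨m, congrArg Additive.toMul ha.symm⟩
  exact ⟨AddMonoidHom.toMultiplicativeRight ((AddMonoidHom.fst _ _).comp g.toAddMonoidHom),
    AddMonoidHom.toMultiplicativeRight ((AddMonoidHom.snd _ _).comp g.toAddMonoidHom),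
    congrArg Prod.fst hgx, congrArg Prod.fst hgy, congrArg Prod.snd hgx, congrArg Prod.snd hgy⟩

/-- The evaluation form of an abelian group and its endomorphisms. -/
def evaluationForm (G : Type*) [CommGroup G] :
    BimulForm (G × Multiplicative (Additive G →+ Additive G)) (Additive G) where
  toFun x y := y.2.toAdd (.ofMul x.1)
  map_mul_left x x' y := map_add y.2.toAdd (.ofMul x.1) (.ofMul x'.1)
  map_mul_right _ _ _ := rfl

/-- An abelian group that is absolutely closed is cyclic modulo `p`-th powers. -/
theorem isCyclic_quotient_of_absolutelyClosed {p n : ℕ} (hp : p.Prime) (hodd : Odd p) (hn : 1 < n)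
    {G : Type u} [CommGroup G] (hAC : AbsolutelyClosed (NilTwoExponent.{u} (p ^ n)) G) :
    IsCyclic (G ⧸ (powMonoidHom p : G →* G).range) := by
  by_contra hcyc
  have hne : ∀ z : G ⧸ (powMonoidHom p : G →* G).range, ∃ y, y ∉ Subgroup.zpowers z := by
    by_contra! h
    obtain ⟨z, hz⟩ := h
    exact hcyc ⟨⟨z, hz⟩⟩
  obtain ⟨x, hx⟩ := hne 1
  obtain ⟨y, hy⟩ := hne x
  obtain ⟨φ, ψ, hφx, hφy, hψx, hψy⟩ := exists_dual_pair hp (fun w => by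
    obtain ⟨w, rfl⟩ := QuotientGroup.mk_surjective w
    rw [← QuotientGroup.mk_pow, QuotientGroup.eq_one_iff]
    exact ⟨w, rfl⟩) (fun h => hx (by rw [h]; exact Subgroup.one_mem _)) hy
  obtain ⟨x, rfl⟩ := QuotientGroup.mk_surjective x
  obtain ⟨y, rfl⟩ := QuotientGroup.mk_surjective y
  have hG : ∀ g : Additive G, p ^ n • g = 0 := fun g => hAC.1.2 g.toMul
  -- `G` is placed as the central subgroup, where each `g` is the commutator of `g` with the
  -- identity endomorphism.
  let ι : G →* (evaluationForm G).Ext := BimulForm.Ext.incl.comp (MonoidHom.mk' (fun g : G =>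
    Multiplicative.ofAdd (Additive.ofMul g)) fun _ _ => rfl)
  have hι : ∀ g, ι g ∈ commutator (evaluationForm G).Ext := fun g => by
    let r : (evaluationForm G).Ext := ⟨(g, 1), 0⟩
    let s : (evaluationForm G).Ext := ⟨(1, .ofAdd (AddMonoidHom.id _)), 0⟩
    have h : ⁅r, s⁆ = ι g := by
      rw [BimulForm.Ext.commutator_eq]
      apply BimulForm.Ext.ext
      · exact commutatorElement_eq_one_iff_mul_comm.mpr (mul_comm _ _)
      · change Additive.ofMul g - 0 = Additive.ofMul g
        rw [sub_zero]
    rw [← h]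
    exact Subgroup.commutator_mem_commutator (Subgroup.mem_top _) (Subgroup.mem_top _)
  refine not_absolutelyClosed_of_dual_pair hp hodd hn
    (BimulForm.Ext.nilTwoExponent hodd.pow ⟨NilTwo.of_comm, fun w => Prod.ext (hAC.1.2 w.1) ?_⟩ hG)
    ι (φ.comp (QuotientGroup.mk' _)) (ψ.comp (QuotientGroup.mk' _)) x y hφx hφy hψx hψy (hι x)
    (hι y) (fun g hg _ _ => ?_) hAC
  · exact AddMonoidHom.ext fun g => hG (w.2.toAdd g)
  · exact congrArg (fun e : (evaluationForm G).Ext => e.snd.toMul) hg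

/-- A bounded abelian `p`-group that is cyclic modulo `p`-th powers is cyclic. -/
theorem isCyclic_of_isCyclic_quotient {p n : ℕ} {G : Type*} [CommGroup G]
    (hG : ∀ g : G, g ^ p ^ n = 1) (hc : IsCyclic (G ⧸ (powMonoidHom p : G →* G).range)) :
    IsCyclic G := by
  obtain ⟨z, hz⟩ := hc.exists_generator
  obtain ⟨z, rfl⟩ := QuotientGroup.mk_surjective z
  have h1 : ∀ g : G, ∃ (a : ℤ) (w : G), g = z ^ a * w ^ p := fun g => by
    obtain ⟨a, ha⟩ := hz g
    obtain ⟨w, hw⟩ := QuotientGroup.eq.mp ((QuotientGroup.mk_zpow _ z a).trans ha)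
    exact ⟨a, w, by rw [show w ^ p = (z ^ a)⁻¹ * g from hw, mul_inv_cancel_left]⟩
  -- Iterating pushes the error into `p ^ m`-th powers, which are trivial at `m = n`.
  have h2 : ∀ m : ℕ, ∀ g : G, ∃ (a : ℤ) (w : G), g = z ^ a * w ^ p ^ m := fun m => by
    induction m with
    | zero => exact fun g => ⟨0, g, by simp⟩
    | succ m ih =>
      intro g
      obtain ⟨a, w, rfl⟩ := ih g
      obtain ⟨b, v, rfl⟩ := h1 w
      refine ⟨a + b * (p ^ m : ℕ), v, ?_⟩
      rw [mul_pow, zpow_add, zpow_mul, zpow_natCast, ← pow_mul v, ← pow_succ', mul_assoc]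
  refine ⟨z, fun g => ?_⟩
  obtain ⟨a, w, rfl⟩ := h2 n g
  exact ⟨a, by rw [hG, mul_one]⟩

/-- An element of order dividing `p` defines a homomorphism from `ZMod p`. -/
theorem exists_monoidHom_zmod {p : ℕ} {C : Type*} [Group C] {x : C} (hx : x ^ p = 1) :
    ∃ ξ : Multiplicative (ZMod p) →* C, ξ (.ofAdd 1) = x := by
  refine ⟨AddMonoidHom.toMultiplicativeLeft (ZMod.lift p ⟨zmultiplesHom _ (Additive.ofMul x), ?_⟩),
    ?_⟩
  · rw [zmultiplesHom_apply, natCast_zsmul]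
    exact hx
  · have h := ZMod.lift_coe p (A := Additive C) ⟨zmultiplesHom _ (Additive.ofMul x), by
      rw [zmultiplesHom_apply, natCast_zsmul]
      exact hx⟩ 1
    rw [Int.cast_one] at h
    refine (congrArg Additive.toMul h).trans ?_
    simp

/-- In an absolutely closed group of exponent `p` the center is cyclic modulo commutators. -/
theorem isCyclic_center_quotient_of_absolutelyClosed {p n : ℕ} (hp : p.Prime) (hodd : Odd p)
    (hn : 1 < n) {G : Type u} [Group G] (hGp : ExponentVariety p G)
    (hAC : AbsolutelyClosed (NilTwoExponent.{u} (p ^ n)) G) :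
    IsCyclic (Subgroup.center G ⧸ (commutator G).subgroupOf (Subgroup.center G)) := by
  rw [isCyclic_center_quotient_iff]
  by_contra! h
  obtain ⟨x, hxc, hx⟩ := h 1 (Subgroup.one_mem _)
  obtain ⟨y, hyc, hy⟩ := h x hxc
  obtain ⟨φ, ψ, hφx, hφy, hψx, hψy⟩ := exists_dual_pair hp (x := Abelianization.of x)
    (y := Abelianization.of y) (fun w => by
      obtain ⟨w, rfl⟩ := QuotientGroup.mk_surjective w
      change Abelianization.of w ^ p = 1
      rw [← map_pow, hGp, map_one])
    (fun h1 => hx 0 (by rw [h1, zpow_zero, map_one]))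
    (fun ⟨a, ha⟩ => hy a (by rw [map_zpow]; exact ha.symm))
  obtain ⟨ξ, hξ⟩ := exists_monoidHom_zmod (x := (⟨x, hxc⟩ : Subgroup.center G))
    (Subtype.ext (hGp x))
  obtain ⟨η, hη⟩ := exists_monoidHom_zmod (x := (⟨y, hyc⟩ : Subgroup.center G))
    (Subtype.ext (hGp y))
  let φ' : G →* Multiplicative (ZMod p) := φ.comp Abelianization.of
  let ψ' : G →* Multiplicative (ZMod p) := ψ.comp Abelianization.of
  -- The inverse of the component of `g` along `x` and `y`. Multiplying by it kills `x` and `y` and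
  -- fixes the common kernel of `φ'` and `ψ'`; `ζ` being central makes `κ` a homomorphism.
  let ζ : G → Subgroup.center G := fun g => (ξ (φ' g) * η (ψ' g))⁻¹
  have hζ : ∀ g g', ζ (g * g') = ζ g * ζ g' := fun g g' => by
    simp only [ζ, map_mul]
    rw [← mul_inv_rev]
    congr 1
    generalize ξ (φ' g) = a
    generalize ξ (φ' g') = b
    generalize η (ψ' g) = c
    generalize η (ψ' g') = d
    have hcomm : ∀ u v : Subgroup.center G, u * v = v * u := fun u v =>
      Subtype.ext (Subgroup.mem_center_iff.mp v.2 u)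
    rw [hcomm a b, mul_assoc, ← mul_assoc a, hcomm (a * c) d, ← mul_assoc]
  let κ : G →* G := MonoidHom.mk' (fun g => g * ζ g) fun g g' => by
    rw [hζ, Subgroup.coe_mul, mul_assoc, mul_assoc, ← mul_assoc g' (ζ g : G),
      Subgroup.mem_center_iff.mp (ζ g).2 g', mul_assoc]
  refine not_absolutelyClosed_of_dual_pair hp hodd hn hAC.1 κ φ' ψ' x y hφx hφy hψx hψy
    ?_ ?_ (fun g hg h1 h2 => ?_) hAC
  · have : κ x = 1 := by
      change x * ((ξ (φ' x) * η (ψ' x))⁻¹ : Subgroup.center G) = 1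
      rw [show φ' x = _ from hφx, show ψ' x = _ from hψx, hξ, map_one, mul_one]
      exact mul_inv_cancel x
    rw [this]; exact Subgroup.one_mem _
  · have : κ y = 1 := by
      change y * ((ξ (φ' y) * η (ψ' y))⁻¹ : Subgroup.center G) = 1
      rw [show φ' y = _ from hφy, show ψ' y = _ from hψy, hη, map_one, one_mul]
      exact mul_inv_cancel y
    rw [this]; exact Subgroup.one_mem _
  · have h3 : g * ((ξ (φ' g) * η (ψ' g))⁻¹ : Subgroup.center G) = 1 := hg
    rw [h1, h2] at h3
    simpa using h3

theorem mainTheorem5 (p n : ℕ) (hp : p.Prime) (hodd : Odd p) (hn : 1 < n) :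
    (∀ (G : Type u) [CommGroup G], NilTwoExponent (p ^ n) G →
      (AbsolutelyClosed (NilTwoExponent.{u} (p ^ n)) G ↔
        IsCyclic (G ⧸ (powMonoidHom p : G →* G).range)) ∧
      (AbsolutelyClosed (NilTwoExponent.{u} (p ^ n)) G ↔ IsCyclic G)) ∧
    (∀ (G : Type u) [Group G], NilTwoExponent (p ^ n) G → ExponentVariety p G →
      (AbsolutelyClosed (NilTwoExponent.{u} (p ^ n)) G ↔
        IsCyclic (Subgroup.center G ⧸ (commutator G).subgroupOf (Subgroup.center G)))) := by
  refine ⟨fun G _ hG => ?_, fun G _ hG hGp =>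
    ⟨isCyclic_center_quotient_of_absolutelyClosed hp hodd hn hGp,
      absolutelyClosed_of_center_quotient hp hodd hG hGp⟩⟩
  have h1 := isCyclic_quotient_of_absolutelyClosed (G := G) hp hodd hn
  have h2 := isCyclic_of_isCyclic_quotient (p := p) hG.2
  have h3 := absolutelyClosed_of_isCyclic hodd.pow hG
  exact ⟨⟨h1, fun h => h3 (h2 h)⟩, fun h => h2 (h1 h), h3⟩
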